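/- Let $n\ge 2$, and let $A=(\langle\alpha_i,\alpha_j\rangle)_{1\le i,j\le n-1}$ be the Cartan matrix of type $A_{n-1}$, that is $\langle\alpha_i,\alpha_i\rangle=2$, $\langle\alpha_i,\alpha_j\rangle=-1$ if $|i-j|=1$, and $\langle\alpha_i,\alpha_j\rangle=0$ otherwise. For $k\in\mathbb N=\{0,1,2,\dots\}$ put $(q)_k=\prod_{r=1}^{k}(1-q^r)$. For $\mathbf m=(m_{i,j})_{1\le i<j\le n}\in\mathbb N^{n(n-1)/2}$ put $$\lambda_i=\sum_{1\le s\le i<\ell\le n}m_{s,\ell}\qquad(1\le i\le n-1),$$ $$B(\mathbf m)=\sum_{\substack{i_1<i_2,\ j_1<j_2\\ j_1>i_2+1}}m_{i_1,j_1}m_{i_2,j_2}+\sum_{\substack{i_1=i_2\\ j_1\le j_2}}m_{i_1,j_1}m_{i_2,j_2}+\sum_{\substack{j_1=j_2\\ i_1<i_2}}m_{i_1,j_1}m_{i_2,j_2}+\sum_{j<i<i+1<j'}m_{i,i+1}m_{j,j'},$$ $$B'(\mathbf m)=\sum_{\substack{i_1\le i_2,\ j_1\le j_2\\ j_1>i_2}}m_{i_1,j_1}m_{i_2,j_2},$$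 where the sums run over pairs of index pairs $1\le i_1<j_1\le n$, $1\le i_2<j_2\le n$ (in the last sum of $B$: $1\le i<i+1\le n$, $1\le j<j'\le n$) subject to the displayed conditions. Then the following sums converge as formal power series in $q,x_1,\dots,x_{n-1}$ (coefficientwise), and (a) $$\sum_{\mathbf m\in\mathbb N^{n(n-1)/2}}\frac{q^{B(\mathbf m)}x_1^{\lambda_1}\cdots x_{n-1}^{\lambda_{n-1}}}{\prod_{1\le i<j\le n}(q)_{m_{i,j}}}=\sum_{\mathbf k\in\mathbb N^{n-1}}\frac{q^{\frac12\mathbf k^{\top}A\mathbf k}x_1^{k_1}\cdots x_{n-1}^{k_{n-1}}}{(q)_{k_1}(q)_{k_2}\cdots(q)_{k_{n-1}}},$$ (b) $$\sum_{\mathbf m\in\mathbb N^{n(n-1)/2}}\frac{q^{B'(\mathbf m)}x_1^{\lambda_1}\cdots x_{n-1}^{\lambda_{n-1}}}{\prod_{1\le i<j\le n}(q)_{m_{i,j}}}=\sum_{\mathbf k\in\mathbb N^{n-1}}\frac{q^{\frac12\mathbf k^{\top}A\mathbf k}x_1^{k_1}\cdots x_{n-1}^{k_{n-1}}}{(q)_{k_1}(q)_{k_2}\cdots(q)_{k_{n-1}}}.$$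 -/

import Mathlib

open scoped PowerSeries Matrix MvPowerSeries.WithPiTopology

namespace PrincipalSubspace

/-- Formal power series in `x₁, …, x_{n-1}` whose coefficients are formal power series in `q`
with integer coefficients. The variable `q` is `PowerSeries.X`. Infinite sums are taken in the
topology of coefficientwise convergence (the coefficient ring `ℤ` is discrete). -/
abbrev QXSeries (n : ℕ) : Type := MvPowerSeries (Fin (n - 1)) ℤ⟦X⟧

/-- The `q`-Pochhammer symbol `(q)_k = (1 - q)(1 - q²)⋯(1 - q^k)`. -/
noncomputable def qPoch (k : ℕ) : ℤ⟦X⟧ :=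
  ∏ i ∈ Finset.range k, (1 - PowerSeries.X ^ (i + 1))

/-- The reciprocal `1 / (q)_k`, as a power series in `q`. -/
noncomputable def qPochInv (k : ℕ) : ℤ⟦X⟧ :=
  PowerSeries.invOfUnit (qPoch k) 1

theorem qPoch_mul_qPochInv (k : ℕ) : qPoch k * qPochInv k = 1 := by
  apply PowerSeries.mul_invOfUnit
  simp [qPoch, map_prod]

/-- Positive roots of type `A_{n-1}`: pairs `(i, j)` with `1 ≤ i < j ≤ n`. Indices are shifted
by one, so that they run through `0, …, n - 1`. -/
abbrev PosRoot (n : ℕ) : Type := {p : Fin n × Fin n // p.1 < p.2}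

/-- The first index `i` of the positive root `(i, j)`. -/
def PosRoot.fst {n : ℕ} (p : PosRoot n) : ℕ := p.1.1

/-- The second index `j` of the positive root `(i, j)`. -/
def PosRoot.snd {n : ℕ} (p : PosRoot n) : ℕ := p.1.2

/-- The quadratic form `B(m)`. -/
def formB {n : ℕ} (m : PosRoot n → ℕ) : ℕ :=
  (∑ a : PosRoot n, ∑ b : PosRoot n,
    if a.fst < b.fst ∧ a.snd < b.snd ∧ b.fst + 1 < a.snd then m a * m b else 0) +
  (∑ a : PosRoot n, ∑ b : PosRoot n,
    if a.fst = b.fst ∧ a.snd ≤ b.snd then m a * m b else 0) +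
  (∑ a : PosRoot n, ∑ b : PosRoot n,
    if a.snd = b.snd ∧ a.fst < b.fst then m a * m b else 0) +
  (∑ a : PosRoot n, ∑ b : PosRoot n,
    if a.snd = a.fst + 1 ∧ b.fst < a.fst ∧ a.fst + 1 < b.snd then m a * m b else 0)

/-- The quadratic form `B'(m)`. -/
def formB' {n : ℕ} (m : PosRoot n → ℕ) : ℕ :=
  ∑ a : PosRoot n, ∑ b : PosRoot n,
    if a.fst ≤ b.fst ∧ a.snd ≤ b.snd ∧ b.fst < a.snd then m a * m b else 0

/-- `λ_i = ∑ m_{s,ℓ}` over `s ≤ i < ℓ`. -/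
def lam {n : ℕ} (m : PosRoot n → ℕ) (i : Fin (n - 1)) : ℕ :=
  ∑ a : PosRoot n, if a.fst ≤ (i : ℕ) ∧ (i : ℕ) < a.snd then m a else 0

/-- The monomial `c · x₁^{e₁} ⋯ x_{n-1}^{e_{n-1}}`. -/
noncomputable def xMonomial {n : ℕ} (e : Fin (n - 1) → ℕ) (c : ℤ⟦X⟧) : QXSeries n :=
  MvPowerSeries.monomial (Finsupp.equivFunOnFinite.symm e) c

theorem xMonomial_eq {n : ℕ} (e : Fin (n - 1) → ℕ) (c : ℤ⟦X⟧) :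
    (xMonomial e c : QXSeries n) =
      MvPowerSeries.C c * ∏ i, (MvPowerSeries.X i : QXSeries n) ^ e i := by
  classical
  have h : ∀ s : Finset (Fin (n - 1)), ∏ i ∈ s, (MvPowerSeries.X i : QXSeries n) ^ e i =
      MvPowerSeries.monomial (∑ i ∈ s, Finsupp.single i (e i)) 1 := by
    intro s
    induction s using Finset.induction_on with
    | empty => simp
    | insert a s ha ih =>
      rw [Finset.prod_insert ha, Finset.sum_insert ha, ih, MvPowerSeries.X_pow_eq,
        MvPowerSeries.monomial_mul_monomial, one_mul]
  have h2 : (∑ i, Finsupp.single i (e i)) = Finsupp.equivFunOnFinite.symm e := by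
    ext j
    simp [Finsupp.finsetSum_apply, Finsupp.single_apply]
  rw [h, h2, ← MvPowerSeries.monomial_zero_eq_C_apply, MvPowerSeries.monomial_mul_monomial,
    zero_add, mul_one]
  rfl

/-- The value `kᵀ A k`, where `A` is the Cartan matrix of type `A_{n-1}` (of size `n - 1`). -/
def cartanForm {r : ℕ} (k : Fin r → ℕ) : ℤ :=
  (fun i => (k i : ℤ)) ⬝ᵥ (CartanMatrix.A r *ᵥ fun i => (k i : ℤ))

/-- The exponent `½ kᵀ A k`; it is a natural number, see `two_mul_halfCartanForm`. -/
def halfCartanForm {r : ℕ} (k : Fin r → ℕ) : ℕ := (cartanForm k / 2).toNat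

theorem cartanForm_succ {r : ℕ} (k : Fin (r + 2) → ℕ) :
    cartanForm k = 2 * (k 0 : ℤ) ^ 2 - 2 * (k 0 : ℤ) * (k 1 : ℤ) +
      cartanForm (fun i : Fin (r + 1) => k i.succ) := by
  have hA : ∀ i j : Fin (r + 1), CartanMatrix.A (r + 2) i.succ j.succ
      = CartanMatrix.A (r + 1) i j := by
    intro i j
    simp [CartanMatrix.A]
  have h0 : ∀ j : Fin r, CartanMatrix.A (r + 2) 0 j.succ.succ = 0 := by
    intro j
    simp only [CartanMatrix.A, Matrix.of_apply]
    simp [Fin.ext_iff]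
  have h0' : ∀ j : Fin r, CartanMatrix.A (r + 2) j.succ.succ 0 = 0 := by
    intro j
    simp only [CartanMatrix.A, Matrix.of_apply]
    simp [Fin.ext_iff]
  have e00 : CartanMatrix.A (r + 2) 0 0 = 2 := by simp [CartanMatrix.A]
  have e01 : CartanMatrix.A (r + 2) 0 (Fin.succ 0) = -1 := by simp [CartanMatrix.A]
  have e10 : CartanMatrix.A (r + 2) (Fin.succ 0) 0 = -1 := by simp [CartanMatrix.A]
  have hcol : ∑ x : Fin (r + 1), (k x.succ : ℤ) * (CartanMatrix.A (r + 2) x.succ 0 * (k 0 : ℤ))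
      = - (k 1 : ℤ) * (k 0 : ℤ) := by
    rw [Fin.sum_univ_succ]
    simp only [h0', e10]
    simp
  have hrow : ∑ x : Fin (r + 1), CartanMatrix.A (r + 2) 0 x.succ * (k x.succ : ℤ)
      = - (k 1 : ℤ) := by
    rw [Fin.sum_univ_succ]
    simp only [h0, e01]
    simp
  unfold cartanForm
  simp only [dotProduct, Matrix.mulVec]
  rw [Fin.sum_univ_succ]
  simp only [Fin.sum_univ_succ (n := r + 1), mul_add, Finset.sum_add_distrib, hA]
  rw [hcol, hrow, e00]
  ring

theorem two_mul_halfCartanForm {r : ℕ} (k : Fin r → ℕ) :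
    2 * (halfCartanForm k : ℤ) = cartanForm k := by
  have key : ∀ (r : ℕ) (k : Fin (r + 1) → ℕ),
      (2 : ℤ) ∣ cartanForm k ∧ (k 0 : ℤ) ^ 2 ≤ cartanForm k := by
    intro r
    induction r with
    | zero =>
      intro k
      have h : cartanForm k = 2 * (k 0 : ℤ) ^ 2 := by
        simp [cartanForm, dotProduct, Matrix.mulVec, CartanMatrix.A]
        ring
      rw [h]
      exact ⟨dvd_mul_right _ _, by nlinarith [sq_nonneg (k 0 : ℤ)]⟩
    | succ r ih =>
      intro k
      obtain ⟨h1, h2⟩ := ih (fun i => k i.succ)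
      have h3 : (k 1 : ℤ) ^ 2 ≤ cartanForm (fun i : Fin (r + 1) => k i.succ) := h2
      rw [cartanForm_succ]
      refine ⟨?_, by nlinarith [sq_nonneg ((k 0 : ℤ) - k 1)]⟩
      obtain ⟨c, hc⟩ := h1
      rw [hc]
      exact ⟨(k 0 : ℤ) ^ 2 - k 0 * k 1 + c, by ring⟩
  have h : (2 : ℤ) ∣ cartanForm k ∧ 0 ≤ cartanForm k := by
    cases r with
    | zero => simp [cartanForm]
    | succ r => exact ⟨(key r k).1, le_trans (sq_nonneg _) (key r k).2⟩
  unfold halfCartanForm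
  omega

/-- The summand `q^{Q(m)} x₁^{λ₁} ⋯ x_{n-1}^{λ_{n-1}} / ∏_{i<j} (q)_{m_{i,j}}` attached to a
form `Q` and to `m`. -/
noncomputable def rootTerm {n : ℕ} (Q : (PosRoot n → ℕ) → ℕ) (m : PosRoot n → ℕ) : QXSeries n :=
  xMonomial (lam m) (PowerSeries.X ^ Q m * ∏ a : PosRoot n, qPochInv (m a))

/-- The summand `q^{½ kᵀ A k} x₁^{k₁} ⋯ x_{n-1}^{k_{n-1}} / ((q)_{k₁} ⋯ (q)_{k_{n-1}})`. -/
noncomputable def fermionicTerm {n : ℕ} (k : Fin (n - 1) → ℕ) : QXSeries n :=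
  xMonomial k (PowerSeries.X ^ halfCartanForm k * ∏ i, qPochInv (k i))

end PrincipalSubspace

namespace PrincipalSubspace

open Finset

/-! Compare coefficients of x^k. Only finitely many `m` have weight `k`, so both convergence and
equality reduce to a finite identity, `IsPeelable.sum_fiber`, proved by induction on the rank by
deleting vertex 0.

Vertices start at 0, as in the code. Contracting `m` to `m'` forgets m_{0,1} and merges m_{0,j} and
m_{1,j} into d_j for j ≥ 2. Given `m'` and k_0, the free parameters are c_j = m_{0,j}, since m_{1,j}
= d_j - c_j and m_{0,1} = k_0 - ∑ c_j. By `IsPeelable.quadForm_contract`, the form of `m` is that of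
`m'` plus k_0² - k_0 k_1 plus ∑_j (d_j - c_j)(m_{0,1} + ∑_l ε_{lj} c_l). The last sum is the
exponent of an iterated q-Vandermonde sum, so summing over c yields 1 / ((q)_{k_0} ∏ (q)_{d_j})
(`IsElimination`). What remains is the term of `m'` times q^{k_0² - k_0 k_1} / (q)_{k_0}, and ½ kᵀAk
obeys the same recursion (k_0 k_1 is absent when vertex 0 is the only one).

The two forms enter this argument only through ε, that is, through the order in which the c_j are
summed. -/

theorem qPochInv_zero : qPochInv 0 = 1 := by
  simpa [qPoch] using qPoch_mul_qPochInv 0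

theorem one_sub_X_pow_ne_zero (k : ℕ) : (1 - PowerSeries.X ^ (k + 1) : ℤ⟦X⟧) ≠ 0 := by
  intro h
  have := congrArg PowerSeries.constantCoeff h
  simp at this

theorem qPoch_ne_zero (k : ℕ) : qPoch k ≠ 0 := fun h => by
  simpa [h] using qPoch_mul_qPochInv k

theorem one_sub_mul_qPochInv_succ (k : ℕ) :
    (1 - PowerSeries.X ^ (k + 1)) * qPochInv (k + 1) = qPochInv k := by
  apply mul_left_cancel₀ (qPoch_ne_zero k)
  have h := qPoch_mul_qPochInv (k + 1)
  rw [show qPoch (k + 1) = qPoch k * (1 - PowerSeries.X ^ (k + 1)) from prod_range_succ _ _] at h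
  rw [qPoch_mul_qPochInv, ← mul_assoc, h]

/-! ### The q-Vandermonde sum -/

/-- The summand of the `q`-Vandermonde sum `qVandermonde`. -/
noncomputable def vandermondeTerm (d k c : ℕ) : ℤ⟦X⟧ :=
  if c ≤ k then
    PowerSeries.X ^ ((d - c) * (k - c)) * (qPochInv (d - c) * qPochInv c * qPochInv (k - c))
  else 0

theorem vandermondeTerm_zero_succ (d k : ℕ) :
    (1 - PowerSeries.X ^ (d + 1)) * vandermondeTerm (d + 1) k 0 =
      PowerSeries.X ^ k * vandermondeTerm d k 0 := by
  simp only [vandermondeTerm, zero_le, if_true, Nat.sub_zero, qPochInv_zero, mul_one]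
  rw [← one_sub_mul_qPochInv_succ d]
  ring

/-- Split 1 - q^{d+1} = (1 - q^{d-c}) + q^{d-c}(1 - q^{c+1}); each piece cancels the top factor of
one q-Pochhammer symbol. -/
theorem vandermondeTerm_succ_succ {d c : ℕ} (k : ℕ) (hc : c < d) :
    (1 - PowerSeries.X ^ (d + 1)) * vandermondeTerm (d + 1) k (c + 1) =
      PowerSeries.X ^ (k - (c + 1)) * vandermondeTerm d k (c + 1) +
        (1 - PowerSeries.X ^ (k - c)) * vandermondeTerm d k c := by
  obtain ⟨a, rfl⟩ := Nat.exists_eq_add_of_lt hc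
  rcases lt_trichotomy c k with h | rfl | h
  · obtain ⟨b, rfl⟩ := Nat.exists_eq_add_of_lt h
    have e1 : c + a + 1 + 1 - (c + 1) = a + 1 := by omega
    have e2 : c + b + 1 - (c + 1) = b := by omega
    have e3 : c + a + 1 - (c + 1) = a := by omega
    have e4 : c + a + 1 - c = a + 1 := by omega
    have e5 : c + b + 1 - c = b + 1 := by omega
    simp only [vandermondeTerm, e1, e2, e3, e4, e5, show c + 1 ≤ c + b + 1 by omega,
      show c ≤ c + b + 1 by omega, if_true]
    rw [← one_sub_mul_qPochInv_succ a, ← one_sub_mul_qPochInv_succ b,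
      ← one_sub_mul_qPochInv_succ c]
    ring
  · simp [vandermondeTerm]
  · simp [vandermondeTerm, show ¬ c + 1 ≤ k by omega, show ¬ c ≤ k by omega]

theorem vandermondeTerm_self_succ (d k : ℕ) :
    (1 - PowerSeries.X ^ (d + 1)) * vandermondeTerm (d + 1) k (d + 1) =
      (1 - PowerSeries.X ^ (k - d)) * vandermondeTerm d k d := by
  rcases lt_trichotomy d k with h | rfl | h
  · obtain ⟨b, rfl⟩ := Nat.exists_eq_add_of_lt h
    have e2 : d + b + 1 - (d + 1) = b := by omega
    have e5 : d + b + 1 - d = b + 1 := by omega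
    simp only [vandermondeTerm, e2, e5, show d + 1 ≤ d + b + 1 by omega,
      show d ≤ d + b + 1 by omega, if_true, Nat.sub_self]
    rw [← one_sub_mul_qPochInv_succ b, ← one_sub_mul_qPochInv_succ d]
    ring
  · simp [vandermondeTerm]
  · simp [vandermondeTerm, show ¬ d + 1 ≤ k by omega, show ¬ d ≤ k by omega]

/-- The `q`-Vandermonde summation
`∑_c q^{(d-c)(k-c)} / ((q)_{d-c} (q)_c (q)_{k-c}) = 1 / ((q)_d (q)_k)`. -/
theorem qVandermonde (d k : ℕ) :
    ∑ c ∈ range (d + 1), vandermondeTerm d k c = qPochInv d * qPochInv k := by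
  induction d with
  | zero => simp [vandermondeTerm, qPochInv_zero]
  | succ d ih =>
    apply mul_left_cancel₀ (one_sub_X_pow_ne_zero d)
    rw [← mul_assoc, one_sub_mul_qPochInv_succ, ← ih, mul_sum, sum_range_succ', sum_range_succ,
      vandermondeTerm_self_succ, vandermondeTerm_zero_succ,
      sum_congr rfl fun c hc => vandermondeTerm_succ_succ k (mem_range.1 hc), sum_add_distrib]
    have h1 := sum_range_succ' (fun c => PowerSeries.X ^ (k - c) * vandermondeTerm d k c) d
    have h2 := sum_range_succ (fun c => (1 - PowerSeries.X ^ (k - c)) * vandermondeTerm d k c) d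
    -- After the recurrences, each term for `d` is hit twice, with weights q^{k-c} and 1 - q^{k-c},
    -- which add up to 1.
    have h3 : ∑ c ∈ range (d + 1), vandermondeTerm d k c =
        ∑ c ∈ range (d + 1), PowerSeries.X ^ (k - c) * vandermondeTerm d k c +
        ∑ c ∈ range (d + 1), (1 - PowerSeries.X ^ (k - c)) * vandermondeTerm d k c := by
      rw [← sum_add_distrib]
      exact sum_congr rfl fun c _ => by ring
    rw [h3, h1, h2, Nat.sub_zero]
    ring

/-! ### Iterated q-Vandermonde sums -/

/-- The finite box `∏ i, {0, …, d i}`. -/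
def box {N : ℕ} (d : Fin N → ℕ) : Finset (Fin N → ℕ) :=
  Fintype.piFinset fun i => range (d i + 1)

theorem mem_box {N : ℕ} {d c : Fin N → ℕ} : c ∈ box d ↔ ∀ i, c i ≤ d i := by
  simp [box]

theorem sum_box_succ {N : ℕ} (d : Fin (N + 1) → ℕ) (f : (Fin (N + 1) → ℕ) → ℤ⟦X⟧) :
    ∑ c ∈ box d, f c =
      ∑ a ∈ range (d 0 + 1), ∑ c ∈ box (fun i => d (Fin.succ i)), f (Fin.cons a c) := by
  rw [← sum_product']
  refine sum_nbij' (fun c => (c 0, fun i => c (Fin.succ i))) (fun x => Fin.cons x.1 x.2)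
    ?_ ?_ ?_ ?_ ?_
  · intro c hc
    rw [mem_box] at hc
    simp only [mem_product, mem_range, mem_box]
    exact ⟨Nat.lt_succ_of_le (hc 0), fun i => hc _⟩
  · rintro ⟨a, c⟩ h
    simp only [mem_product, mem_range, mem_box] at h
    rw [mem_box]
    intro i
    cases i using Fin.cases with
    | zero => exact Nat.le_of_lt_succ h.1
    | succ i => simpa using h.2 i
  · intro c _
    exact Fin.cons_self_tail c
  · rintro ⟨a, c⟩ _
    simp
  · intro c _
    exact congrArg f (Fin.cons_self_tail c).symm

/-- The summand of an iterated `q`-Vandermonde sum. The index `l` is treated after the index `j`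
when `ε l j = 1`, and before it when `ε l j = 0`. -/
noncomputable def eliminationTerm (ε : ℕ → ℕ → ℕ) {N : ℕ} (d : Fin N → ℕ) (k : ℕ)
    (c : Fin N → ℕ) : ℤ⟦X⟧ :=
  if ∑ l, c l ≤ k then
    PowerSeries.X ^ (∑ j : Fin N, (d j - c j) * (k - ∑ l, c l + ∑ l : Fin N, ε l j * c l)) *
      ((∏ j, qPochInv (d j - c j) * qPochInv (c j)) * qPochInv (k - ∑ l, c l))
  else 0

/-- The rule `ε` describes an order of elimination for which the iterated `q`-Vandermonde sum
can be evaluated. -/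
def IsElimination (ε : ℕ → ℕ → ℕ) : Prop :=
  ∀ (N : ℕ) (d : Fin N → ℕ) (k : ℕ),
    ∑ c ∈ box d, eliminationTerm ε d k c = (∏ j, qPochInv (d j)) * qPochInv k

/-- Elimination from the largest index down to the smallest one. -/
def descending (l j : ℕ) : ℕ := if l < j then 1 else 0

/-- Elimination of the index `0`, and then from the largest index down to `1`. -/
def zeroFirst (l j : ℕ) : ℕ := if (j = 0 ∧ 0 < l) ∨ (0 < l ∧ l < j) then 1 else 0

/-- For j > 0 the value `a` at index 0 cancels from the exponent, because ε(0, j) = 1. It survives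
only in a single Vandermonde term, so it can be summed innermost. -/
theorem eliminationTerm_descending_cons {N : ℕ} (d : Fin (N + 1) → ℕ) (k a : ℕ)
    (c : Fin N → ℕ) :
    eliminationTerm descending d k (Fin.cons a c) =
      if ∑ l, c l ≤ k then
        PowerSeries.X ^ (∑ j : Fin N, (d j.succ - c j) *
            (k - ∑ l, c l + ∑ l : Fin N, descending l j * c l)) *
          (∏ j : Fin N, qPochInv (d j.succ - c j) * qPochInv (c j)) *
          vandermondeTerm (d 0) (k - ∑ l, c l) a
      else 0 := by
  have hε : ∀ l j : ℕ, descending (l + 1) (j + 1) = descending l j := by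
    intro l j
    simp [descending]
  have h0 : ∀ l : ℕ, descending l 0 = 0 := by
    intro l
    simp [descending]
  have h1 : ∀ j : ℕ, descending 0 (j + 1) = 1 := by
    intro j
    simp [descending]
  unfold eliminationTerm vandermondeTerm
  simp only [Fin.sum_univ_succ, Fin.prod_univ_succ, Fin.cons_zero, Fin.cons_succ, Fin.val_zero,
    Fin.val_succ, hε, h0, h1, one_mul, zero_mul, sum_const_zero, add_zero]
  by_cases h : a + ∑ l, c l ≤ k
  · have h2 : ∑ l, c l ≤ k := by omega
    have h3 : a ≤ k - ∑ l, c l := by omega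
    have h4 : k - (a + ∑ l, c l) = k - ∑ l, c l - a := by omega
    have h5 : ∀ s, k - ∑ l, c l - a + (a + s) = k - ∑ l, c l + s := by omega
    simp only [h, h2, h3, h4, h5, if_true, pow_add]
    ring
  · by_cases h2 : ∑ l, c l ≤ k
    · have h3 : ¬ a ≤ k - ∑ l, c l := by omega
      simp [h, h2, h3]
    · simp [h, h2]

theorem isElimination_descending : IsElimination descending := by
  intro N
  induction N with
  | zero =>
    intro d k
    have : box d = {d} := by
      ext c
      simp [mem_box, Subsingleton.elim c d]
    simp [this, eliminationTerm]
  | succ N ih =>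
    intro d k
    rw [sum_box_succ, sum_comm]
    simp only [eliminationTerm_descending_cons]
    have : ∀ c : Fin N → ℕ, ∑ a ∈ range (d 0 + 1), (if ∑ l, c l ≤ k then
        PowerSeries.X ^ (∑ j : Fin N, (d j.succ - c j) *
            (k - ∑ l, c l + ∑ l : Fin N, descending l j * c l)) *
          (∏ j : Fin N, qPochInv (d j.succ - c j) * qPochInv (c j)) *
          vandermondeTerm (d 0) (k - ∑ l, c l) a
      else 0) = qPochInv (d 0) * eliminationTerm descending (fun j => d (Fin.succ j)) k c := by
      intro c
      unfold eliminationTerm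
      split_ifs
      · rw [← mul_sum, qVandermonde]
        ring
      · simp
    simp only [this]
    rw [← mul_sum, ih, Fin.prod_univ_succ]
    ring

/-- Here the exponent at index 0 is independent of `c`, and the other indices see `a` only through
`k - a`. They can thus be summed first, leaving a Vandermonde sum in `a`. -/
theorem eliminationTerm_zeroFirst_cons {N : ℕ} (d : Fin (N + 1) → ℕ) (k a : ℕ)
    (c : Fin N → ℕ) :
    eliminationTerm zeroFirst d k (Fin.cons a c) =
      if a ≤ k then
        PowerSeries.X ^ ((d 0 - a) * (k - a)) * (qPochInv (d 0 - a) * qPochInv a) *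
          eliminationTerm descending (fun j => d (Fin.succ j)) (k - a) c
      else 0 := by
  have hε : ∀ l j : ℕ, zeroFirst (l + 1) (j + 1) = descending l j := by
    intro l j
    simp [zeroFirst, descending]
  have h0 : ∀ l : ℕ, zeroFirst (l + 1) 0 = 1 := by
    intro l
    simp [zeroFirst]
  have h1 : ∀ j : ℕ, zeroFirst 0 j = 0 := by
    intro j
    simp [zeroFirst]
  unfold eliminationTerm
  simp only [Fin.sum_univ_succ, Fin.prod_univ_succ, Fin.cons_zero, Fin.cons_succ, Fin.val_zero,
    Fin.val_succ, hε, h0, h1, one_mul, zero_mul, zero_add]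
  by_cases h : a + ∑ l, c l ≤ k
  · have h2 : ∑ l, c l ≤ k - a := by omega
    have h3 : a ≤ k := by omega
    have h4 : k - (a + ∑ l, c l) = k - a - ∑ l, c l := by omega
    have h5 : k - a - ∑ l, c l + ∑ l, c l = k - a := by omega
    simp only [h, h2, h3, h4, h5, if_true, pow_add]
    ring
  · by_cases h2 : a ≤ k
    · have h3 : ¬ ∑ l, c l ≤ k - a := by omega
      simp [h, h2, h3]
    · simp [h, h2]

theorem isElimination_zeroFirst : IsElimination zeroFirst := by
  intro N d k
  cases N with
  | zero =>
    have : box d = {d} := by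
      ext c
      simp [mem_box, Subsingleton.elim c d]
    simp [this, eliminationTerm]
  | succ N =>
    rw [sum_box_succ]
    simp only [eliminationTerm_zeroFirst_cons]
    have : ∀ a : ℕ, ∑ c ∈ box (fun j => d (Fin.succ j)), (if a ≤ k then
        PowerSeries.X ^ ((d 0 - a) * (k - a)) * (qPochInv (d 0 - a) * qPochInv a) *
          eliminationTerm descending (fun j => d (Fin.succ j)) (k - a) c
      else 0) = (∏ j : Fin N, qPochInv (d j.succ)) * vandermondeTerm (d 0) k a := by
      intro a
      unfold vandermondeTerm
      split_ifs
      · rw [← mul_sum, isElimination_descending]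
        ring
      · simp
    simp only [this]
    rw [← mul_sum, qVandermonde, Fin.prod_univ_succ]
    ring

/-! ### Positive roots, contraction and weights -/

/-- The root `(0, l + 1)`. -/
def rowRoot {N : ℕ} (l : Fin N) : PosRoot (N + 1) := ⟨(0, l.succ), Fin.succ_pos l⟩

/-- The root `(i + 1, j + 1)` attached to the root `(i, j)`. -/
def shiftRoot {N : ℕ} (p : PosRoot N) : PosRoot (N + 1) :=
  ⟨(p.1.1.succ, p.1.2.succ), Fin.succ_lt_succ_iff.2 p.2⟩

@[simp] theorem fst_rowRoot {N : ℕ} (l : Fin N) : (rowRoot l).fst = 0 := rfl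
@[simp] theorem snd_rowRoot {N : ℕ} (l : Fin N) : (rowRoot l).snd = l + 1 := rfl
@[simp] theorem fst_shiftRoot {N : ℕ} (p : PosRoot N) : (shiftRoot p).fst = p.fst + 1 := rfl
@[simp] theorem snd_shiftRoot {N : ℕ} (p : PosRoot N) : (shiftRoot p).snd = p.snd + 1 := rfl

theorem PosRoot.fst_lt_snd {N : ℕ} (p : PosRoot N) : p.fst < p.snd := p.2

theorem PosRoot.snd_lt {N : ℕ} (p : PosRoot N) : p.snd < N := p.1.2.2

theorem bijective_rowRoot_shiftRoot (N : ℕ) :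
    Function.Bijective (Sum.elim rowRoot shiftRoot : Fin N ⊕ PosRoot N → PosRoot (N + 1)) := by
  constructor
  · rintro (l | p) (l' | p') h
    · simpa [rowRoot, Fin.ext_iff] using h
    · simp [rowRoot, shiftRoot, Fin.ext_iff] at h
    · simp [rowRoot, shiftRoot, Fin.ext_iff] at h
    · obtain ⟨⟨a, b⟩, hp⟩ := p
      obtain ⟨⟨a', b'⟩, hp'⟩ := p'
      simpa [shiftRoot] using h
  · rintro ⟨⟨a, b⟩, h⟩
    cases b using Fin.cases with
    | zero => exact absurd h (Fin.not_lt_zero a)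
    | succ b =>
      cases a using Fin.cases with
      | zero => exact ⟨Sum.inl b, rfl⟩
      | succ a => exact ⟨Sum.inr ⟨(a, b), Fin.succ_lt_succ_iff.1 h⟩, rfl⟩

/-- The roots for `N + 1` are those starting at `0` and the shifted roots for `N`. -/
noncomputable def rootEquiv (N : ℕ) : Fin N ⊕ PosRoot N ≃ PosRoot (N + 1) :=
  Equiv.ofBijective _ (bijective_rowRoot_shiftRoot N)

theorem sum_posRoot_succ {R : Type*} [AddCommMonoid R] {N : ℕ} (f : PosRoot (N + 1) → R) :
    ∑ a, f a = ∑ l, f (rowRoot l) + ∑ p, f (shiftRoot p) := by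
  rw [← (rootEquiv N).sum_comp, Fintype.sum_sum_type]
  rfl

theorem prod_posRoot_succ {R : Type*} [CommMonoid R] {N : ℕ} (f : PosRoot (N + 1) → R) :
    ∏ a, f a = (∏ l, f (rowRoot l)) * ∏ p, f (shiftRoot p) := by
  rw [← (rootEquiv N).prod_comp, Fintype.prod_sum_type]
  rfl

/-- The multiplicity function with given values on the roots starting at `0` and on the others. -/
noncomputable def glue {N : ℕ} (c : Fin N → ℕ) (e : PosRoot N → ℕ) (a : PosRoot (N + 1)) : ℕ :=
  Sum.elim c e ((rootEquiv N).symm a)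

@[simp] theorem glue_rowRoot {N : ℕ} (c : Fin N → ℕ) (e : PosRoot N → ℕ) (l : Fin N) :
    glue c e (rowRoot l) = c l := by
  have : rowRoot l = rootEquiv N (Sum.inl l) := rfl
  rw [glue, this, Equiv.symm_apply_apply]
  rfl

@[simp] theorem glue_shiftRoot {N : ℕ} (c : Fin N → ℕ) (e : PosRoot N → ℕ) (p : PosRoot N) :
    glue c e (shiftRoot p) = e p := by
  have : shiftRoot p = rootEquiv N (Sum.inr p) := rfl
  rw [glue, this, Equiv.symm_apply_apply]
  rfl

theorem posRoot_fun_ext {N : ℕ} {m m' : PosRoot (N + 1) → ℕ}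
    (h1 : ∀ l, m (rowRoot l) = m' (rowRoot l)) (h2 : ∀ p, m (shiftRoot p) = m' (shiftRoot p)) :
    m = m' := by
  funext a
  obtain ⟨x, rfl⟩ := (rootEquiv N).surjective a
  rcases x with l | p
  · exact h1 l
  · exact h2 p

/-- Removal of the vertex `0`: the roots `(0, j)` and `(1, j)` are identified. -/
noncomputable def contract {N : ℕ} (m : PosRoot (N + 2) → ℕ) : PosRoot (N + 1) → ℕ :=
  glue (fun l => m (rowRoot l.succ) + m (shiftRoot (rowRoot l)))
    (fun p => m (shiftRoot (shiftRoot p)))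

theorem lam_eq {N : ℕ} (m : PosRoot (N + 1) → ℕ) (i : Fin N) :
    lam m i = (∑ l : Fin N, if (i : ℕ) ≤ l then m (rowRoot l) else 0) +
      ∑ p : PosRoot N, if p.fst < i ∧ (i : ℕ) ≤ p.snd then m (shiftRoot p) else 0 := by
  unfold lam
  rw [sum_posRoot_succ]
  refine congrArg₂ _ (sum_congr rfl fun l _ => if_congr ?_ rfl rfl)
    (sum_congr rfl fun p _ => if_congr ?_ rfl rfl)
  · simp
  · simp

theorem lam_zero {N : ℕ} (m : PosRoot (N + 2) → ℕ) :
    lam m (0 : Fin (N + 1)) = m (rowRoot 0) + ∑ l : Fin N, m (rowRoot l.succ) := by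
  rw [lam_eq, Fin.sum_univ_succ]
  simp

/-- The roots (0, j) and (1, j) cover the same vertices apart from 0, and (0, 1) covers only vertex
0, so contraction loses no weight elsewhere. -/
theorem lam_succ {N : ℕ} (m : PosRoot (N + 2) → ℕ) (i : Fin N) :
    lam m (i.succ : Fin (N + 1)) = lam (contract m) i := by
  rw [lam_eq, lam_eq, sum_posRoot_succ, Fin.sum_univ_succ, contract]
  simp only [glue_rowRoot, glue_shiftRoot, ← add_assoc]
  refine congrArg₂ _ ?_ (sum_congr rfl fun p _ => if_congr ?_ rfl rfl)
  · have h0 : (if (i.succ : ℕ) ≤ (0 : Fin (N + 1)) then m (rowRoot 0) else 0) = 0 :=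
      if_neg (by simp)
    rw [h0, zero_add, ← sum_add_distrib]
    refine sum_congr rfl fun l _ => ?_
    have h1 : ((i.succ : ℕ) ≤ l.succ) ↔ (i : ℕ) ≤ l := by simp
    have h2 : ((rowRoot l).fst < (i.succ : ℕ) ∧ (i.succ : ℕ) ≤ (rowRoot l).snd) ↔
        (i : ℕ) ≤ l := by simp
    rw [if_congr h1 rfl rfl, if_congr h2 rfl rfl]
    split_ifs <;> rfl
  · simp

/-- The multiplicity functions of weight `k`. -/
def fiber {N : ℕ} (k : Fin N → ℕ) : Finset (PosRoot (N + 1) → ℕ) :=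
  (Fintype.piFinset fun _ => range (∑ i, k i + 1)).filter fun m => ∀ i : Fin N, lam m i = k i

theorem mem_fiber {N : ℕ} {k : Fin N → ℕ} {m : PosRoot (N + 1) → ℕ} :
    m ∈ fiber k ↔ ∀ i : Fin N, lam m i = k i := by
  unfold fiber
  rw [mem_filter, and_iff_right_iff_imp]
  intro h
  rw [Fintype.mem_piFinset]
  intro a
  have ha : a.fst < N := lt_of_lt_of_le a.fst_lt_snd (Nat.le_of_lt_succ a.snd_lt)
  rw [mem_range, Nat.lt_succ_iff]
  -- A root covers its own first index, so its multiplicity is bounded by the weight there; this is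
  -- what makes the fibre finite.
  calc m a ≤ lam m (⟨a.fst, ha⟩ : Fin N) := by
        have := single_le_sum (s := univ) (a := a) (f := fun b : PosRoot (N + 1) =>
          if b.fst ≤ a.fst ∧ a.fst < b.snd then m b else 0) (fun _ _ => Nat.zero_le _) (mem_univ _)
        simpa [a.fst_lt_snd, lam] using this
    _ = k ⟨a.fst, ha⟩ := h _
    _ ≤ _ := single_le_sum (fun _ _ => Nat.zero_le _) (mem_univ _)

/-! ### Quadratic forms under contraction -/

/-- The quadratic form with coefficients `K i₁ j₁ i₂ j₂`. -/
def quadForm (K : ℕ → ℕ → ℕ → ℕ → ℕ) {n : ℕ} (m : PosRoot n → ℕ) : ℕ :=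
  ∑ a : PosRoot n, ∑ b : PosRoot n, K a.fst a.snd b.fst b.snd * (m a * m b)

/-- Conditions on the coefficients of a quadratic form under which it behaves well with respect to
the removal of the vertex `0`. -/
structure IsPeelable (K : ℕ → ℕ → ℕ → ℕ → ℕ) (ε : ℕ → ℕ → ℕ) : Prop where
  shift : ∀ i j i' j', K (i + 1) (j + 1) (i' + 1) (j' + 1) = K i j i' j'
  row_row : ∀ l l', K 0 (l + 2) 0 (l' + 2) = K 0 (l + 1) 0 (l' + 1)
  zero_row : ∀ l, K 0 1 0 (l + 2) + K 0 (l + 2) 0 1 = 1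
  zero_zero : K 0 1 0 1 = 1
  zero_shift : ∀ i j, i < j → K 0 1 (i + 1) (j + 1) + K (i + 1) (j + 1) 0 1 = 0
  row_shift : ∀ l i j, i < j → K 0 (l + 2) (i + 2) (j + 2) + K (i + 2) (j + 2) 0 (l + 2) =
    K 0 (l + 1) (i + 1) (j + 1) + K (i + 1) (j + 1) 0 (l + 1)
  -- The coefficient of m_{0,l+2} m_{1,j+2}. The 1 on the left comes from k_0 k_1, and ε is the
  -- discrepancy that dictates the summation order.
  row_one : ∀ l j, K 0 (l + 2) 1 (j + 2) + K 1 (j + 2) 0 (l + 2) + 1 =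
    K 0 (l + 1) 0 (j + 1) + K 0 (j + 1) 0 (l + 1) + ε l j

theorem quadForm_succ {K : ℕ → ℕ → ℕ → ℕ → ℕ}
    (hK : ∀ i j i' j', K (i + 1) (j + 1) (i' + 1) (j' + 1) = K i j i' j')
    {N : ℕ} (m : PosRoot (N + 1) → ℕ) :
    quadForm K m =
      (∑ l : Fin N, ∑ l' : Fin N,
        K 0 (l + 1) 0 (l' + 1) * (m (rowRoot l) * m (rowRoot l'))) +
      (∑ l : Fin N, ∑ p : PosRoot N,
        (K 0 (l + 1) (p.fst + 1) (p.snd + 1) + K (p.fst + 1) (p.snd + 1) 0 (l + 1)) *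
          (m (rowRoot l) * m (shiftRoot p))) +
      quadForm K (fun p => m (shiftRoot p)) := by
  unfold quadForm
  simp only [sum_posRoot_succ, fst_rowRoot, snd_rowRoot, fst_shiftRoot, snd_shiftRoot,
    sum_add_distrib, hK, add_mul]
  rw [sum_comm (s := (univ : Finset (PosRoot N))) (t := (univ : Finset (Fin N)))]
  simp only [mul_comm (m (shiftRoot _)) (m (rowRoot _))]
  ring

/-- The behaviour of a peelable quadratic form under the removal of the vertex `0`. -/
theorem IsPeelable.quadForm_contract {K : ℕ → ℕ → ℕ → ℕ → ℕ} {ε : ℕ → ℕ → ℕ}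
    (h : IsPeelable K ε) {N : ℕ} (m : PosRoot (N + 2) → ℕ) :
    quadForm K m +
        (m (rowRoot 0) + ∑ l : Fin N, m (rowRoot l.succ)) * ∑ l : Fin N, contract m (rowRoot l) =
      quadForm K (contract m) + (m (rowRoot 0) + ∑ l : Fin N, m (rowRoot l.succ)) ^ 2 +
        ∑ j : Fin N, m (shiftRoot (rowRoot j)) *
          (m (rowRoot 0) + ∑ l : Fin N, ε l j * m (rowRoot l.succ)) := by
  rw [quadForm_succ h.shift m, quadForm_succ h.shift (fun p => m (shiftRoot p)),
    quadForm_succ h.shift (contract m)]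
  simp only [contract, glue_rowRoot, glue_shiftRoot]
  generalize quadForm K (fun p => m (shiftRoot (shiftRoot p))) = Q
  generalize hc0 : m (rowRoot 0) = c0
  obtain ⟨c, hc⟩ : ∃ c : Fin N → ℕ, c = fun l => m (rowRoot l.succ) := ⟨_, rfl⟩
  obtain ⟨d, hd⟩ : ∃ d : Fin N → ℕ, d = fun l => m (shiftRoot (rowRoot l)) := ⟨_, rfl⟩
  obtain ⟨e, he⟩ : ∃ e : PosRoot N → ℕ, e = fun p => m (shiftRoot (shiftRoot p)) := ⟨_, rfl⟩
  have hc' : ∀ l, m (rowRoot l.succ) = c l := fun l => by rw [hc]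
  have hd' : ∀ l, m (shiftRoot (rowRoot l)) = d l := fun l => by rw [hd]
  have he' : ∀ l, m (shiftRoot (shiftRoot l)) = e l := fun l => by rw [he]
  simp only [Fin.sum_univ_succ, sum_posRoot_succ, hc0, hc', hd', he', fst_rowRoot, snd_rowRoot,
    fst_shiftRoot, snd_shiftRoot, Fin.val_zero, Fin.val_succ, zero_add, h.zero_zero, h.row_row,
    add_assoc, Nat.reduceAdd, one_mul]
  have z1 : ∑ l : Fin N, (K 0 1 1 (l + 2) + K 1 (l + 2) 0 1) * (c0 * d l) = 0 :=
    sum_eq_zero fun l _ => by rw [h.zero_shift 0 (l + 1) (by omega), zero_mul]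
  have z2 : ∑ p : PosRoot N, (K 0 1 (p.fst + 2) (p.snd + 2) + K (p.fst + 2) (p.snd + 2) 0 1) *
      (c0 * e p) = 0 :=
    sum_eq_zero fun p _ => by
      rw [h.zero_shift (p.fst + 1) (p.snd + 1) (by have := p.fst_lt_snd; omega), zero_mul]
  have z3 : ∑ l : Fin N, K 0 1 0 (l + 2) * (c0 * c l) + ∑ l : Fin N, K 0 (l + 2) 0 1 * (c l * c0)
      = c0 * ∑ l, c l := by
    rw [← sum_add_distrib, mul_sum]
    refine sum_congr rfl fun l _ => ?_
    rw [mul_comm (c l) c0, ← add_mul, h.zero_row, one_mul]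
  have z4 : ∑ l : Fin N, ∑ p : PosRoot N, (K 0 (l + 2) (p.fst + 2) (p.snd + 2) +
      K (p.fst + 2) (p.snd + 2) 0 (l + 2)) * (c l * e p) =
      ∑ l : Fin N, ∑ p : PosRoot N, (K 0 (l + 1) (p.fst + 1) (p.snd + 1) +
      K (p.fst + 1) (p.snd + 1) 0 (l + 1)) * (c l * e p) :=
    sum_congr rfl fun l _ => sum_congr rfl fun p _ => by rw [h.row_shift _ _ _ p.fst_lt_snd]
  -- The mixed terms c_l d_j, the only ones in which ε occurs; here `d` is the row of roots starting
  -- at 1, not the merged row.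
  have z5 : ∑ l : Fin N, ∑ j : Fin N, (K 0 (l + 2) 1 (j + 2) + K 1 (j + 2) 0 (l + 2)) *
      (c l * d j) + (∑ l, c l) * ∑ j, d j =
      ∑ l : Fin N, ∑ j : Fin N, K 0 (l + 1) 0 (j + 1) * (c l * d j) +
      ∑ l : Fin N, ∑ j : Fin N, K 0 (l + 1) 0 (j + 1) * (d l * c j) +
      ∑ j : Fin N, d j * ∑ l : Fin N, ε l j * c l := by
    rw [sum_comm (f := fun l j : Fin N => K 0 (l + 1) 0 (j + 1) * (d l * c j)), sum_mul_sum]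
    simp only [mul_sum]
    rw [sum_comm (f := fun j l : Fin N => d j * (ε l j * c l))]
    simp only [← sum_add_distrib]
    refine sum_congr rfl fun l _ => sum_congr rfl fun j _ => ?_
    linear_combination (c l * d j) * h.row_one l j
  simp only [mul_add, add_mul, sum_add_distrib, ← sum_mul] at z1 z2 z3 z4 z5 ⊢
  linear_combination z1 + z2 + z3 + z4 + z5

/-! ### Recursion for the Cartan form -/

theorem halfCartanForm_fin_zero (k : Fin 0 → ℕ) : halfCartanForm k = 0 := by
  simp [halfCartanForm, cartanForm]

theorem halfCartanForm_fin_one (k : Fin 1 → ℕ) : halfCartanForm k = k 0 ^ 2 := by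
  have h := two_mul_halfCartanForm k
  have h1 : cartanForm k = 2 * (k 0 : ℤ) ^ 2 := by
    simp [cartanForm, dotProduct, Matrix.mulVec, CartanMatrix.A]
    ring
  rw [h1] at h
  exact_mod_cast mul_left_cancel₀ two_ne_zero h

theorem halfCartanForm_succ {N : ℕ} (k : Fin (N + 2) → ℕ) :
    halfCartanForm k + k 0 * k 1 = halfCartanForm (fun i : Fin (N + 1) => k i.succ) + k 0 ^ 2 := by
  have h := two_mul_halfCartanForm k
  have h' := two_mul_halfCartanForm (fun i : Fin (N + 1) => k i.succ)
  rw [cartanForm_succ, ← h'] at h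
  zify
  linarith

/-- `τ` is k_1, or 0 when there is no vertex 1; this lets the induction step treat both cases alike.
-/
theorem exists_halfCartanForm_add_mul {N : ℕ} (k : Fin (N + 1) → ℕ) :
    ∃ τ, (∀ m ∈ fiber (fun i : Fin N => k i.succ), ∑ l : Fin N, m (rowRoot l) = τ) ∧
      k 0 * τ + halfCartanForm k = k 0 ^ 2 + halfCartanForm (fun i : Fin N => k i.succ) := by
  cases N with
  | zero => exact ⟨0, by simp, by simp [halfCartanForm_fin_one, halfCartanForm_fin_zero]⟩
  | succ N =>
    refine ⟨k 1, fun m hm => ?_, ?_⟩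
    · have h0 := mem_fiber.1 hm 0
      rw [lam_zero] at h0
      rw [Fin.sum_univ_succ, h0]
      rfl
    · rw [add_comm, halfCartanForm_succ, add_comm]

/-! ### Fibres of the contraction and the induction -/

theorem contract_mem_fiber {N : ℕ} {k : Fin (N + 1) → ℕ} {m : PosRoot (N + 2) → ℕ}
    (hm : m ∈ fiber k) : contract m ∈ fiber (fun i : Fin N => k i.succ) := by
  rw [mem_fiber] at hm ⊢
  intro i
  rw [← lam_succ]
  exact hm i.succ

/-- Multiplicity functions with a given contraction `m'` and a given weight `k₀` at the vertex `0`
are described by the multiplicities of the roots `(0, j)`, `j ≥ 2`. -/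
noncomputable def expand {N : ℕ} (m' : PosRoot (N + 1) → ℕ) (k₀ : ℕ) (c : Fin N → ℕ) :
    PosRoot (N + 2) → ℕ :=
  glue (Fin.cons (k₀ - ∑ l, c l) c)
    (glue (fun l => m' (rowRoot l) - c l) fun p => m' (shiftRoot p))

theorem contract_expand {N : ℕ} (m' : PosRoot (N + 1) → ℕ) (k₀ : ℕ) {c : Fin N → ℕ}
    (hc : ∀ l, c l ≤ m' (rowRoot l)) : contract (expand m' k₀ c) = m' := by
  refine posRoot_fun_ext (fun l => ?_) fun p => ?_
  · simp [contract, expand, hc l]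
  · simp [contract, expand]

theorem expand_mem_fiber {N : ℕ} {k : Fin (N + 1) → ℕ} {m' : PosRoot (N + 1) → ℕ}
    (hm : m' ∈ fiber (fun i : Fin N => k i.succ)) {c : Fin N → ℕ}
    (hc : ∀ l, c l ≤ m' (rowRoot l)) (hk : ∑ l, c l ≤ k 0) : expand m' (k 0) c ∈ fiber k := by
  rw [mem_fiber] at hm ⊢
  intro i
  cases i using Fin.cases with
  | zero =>
    rw [lam_zero]
    simp [expand, hk]
  | succ i =>
    rw [lam_succ, contract_expand m' _ hc]
    exact hm i

theorem expand_contract {N : ℕ} {k : Fin (N + 1) → ℕ} {m : PosRoot (N + 2) → ℕ}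
    (hm : m ∈ fiber k) :
    expand (contract m) (k 0) (fun l => m (rowRoot l.succ)) = m := by
  rw [mem_fiber] at hm
  have h0 := hm 0
  rw [lam_zero] at h0
  refine posRoot_fun_ext (fun l => ?_) fun p => ?_
  · cases l using Fin.cases with
    | zero => simp [expand, ← h0]
    | succ l => simp [expand]
  · obtain ⟨x, rfl⟩ := (rootEquiv N).surjective p
    rcases x with l | p
    · change expand _ _ _ (shiftRoot (rowRoot l)) = m (shiftRoot (rowRoot l))
      simp [expand, contract]
    · change expand _ _ _ (shiftRoot (shiftRoot p)) = m (shiftRoot (shiftRoot p))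
      simp [expand, contract]

/-- The coefficient of the summand attached to `m` and to a form `Q`. -/
noncomputable def rootCoeff {n : ℕ} (Q : (PosRoot n → ℕ) → ℕ) (m : PosRoot n → ℕ) : ℤ⟦X⟧ :=
  PowerSeries.X ^ Q m * ∏ a : PosRoot n, qPochInv (m a)

theorem sum_fiber_contract {N : ℕ} (k : Fin (N + 1) → ℕ) {m' : PosRoot (N + 1) → ℕ}
    (hm : m' ∈ fiber (fun i : Fin N => k i.succ)) (f : (PosRoot (N + 2) → ℕ) → ℤ⟦X⟧) :
    ∑ m ∈ fiber k with contract m = m', f m =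
      ∑ c ∈ box (fun l => m' (rowRoot l)) with ∑ l, c l ≤ k 0, f (expand m' (k 0) c) := by
  refine sum_nbij' (fun m l => m (rowRoot l.succ)) (fun c => expand m' (k 0) c) ?_ ?_ ?_ ?_ ?_
  · intro m h
    obtain ⟨h1, rfl⟩ := mem_filter.1 h
    have h0 := mem_fiber.1 h1 0
    rw [lam_zero] at h0
    rw [mem_filter, mem_box]
    refine ⟨fun l => by simp [contract], ?_⟩
    rw [← h0]
    exact Nat.le_add_left _ _
  · intro c h
    obtain ⟨h1, h2⟩ := mem_filter.1 h
    rw [mem_box] at h1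
    exact mem_filter.2 ⟨expand_mem_fiber hm h1 h2, contract_expand m' _ h1⟩
  · intro m h
    obtain ⟨h1, rfl⟩ := mem_filter.1 h
    exact expand_contract h1
  · intro c _
    funext l
    simp [expand]
  · intro m h
    obtain ⟨h1, rfl⟩ := mem_filter.1 h
    rw [expand_contract h1]

theorem IsPeelable.rootCoeff_expand {K : ℕ → ℕ → ℕ → ℕ → ℕ} {ε : ℕ → ℕ → ℕ}
    (h : IsPeelable K ε) {N : ℕ} (k₀ : ℕ) (m' : PosRoot (N + 1) → ℕ) {c : Fin N → ℕ}
    (hc : ∀ l, c l ≤ m' (rowRoot l)) (hk : ∑ l, c l ≤ k₀) :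
    PowerSeries.X ^ (k₀ * ∑ l : Fin N, m' (rowRoot l)) *
        rootCoeff (quadForm K) (expand m' k₀ c) =
      PowerSeries.X ^ (quadForm K m' + k₀ ^ 2) * (∏ p : PosRoot N, qPochInv (m' (shiftRoot p))) *
        eliminationTerm ε (fun l => m' (rowRoot l)) k₀ c := by
  have hQ := h.quadForm_contract (expand m' k₀ c)
  rw [contract_expand m' k₀ hc] at hQ
  have e0 : expand m' k₀ c (rowRoot 0) = k₀ - ∑ l, c l := by simp [expand]
  have e1 : ∀ l : Fin N, expand m' k₀ c (rowRoot l.succ) = c l := by simp [expand]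
  have e2 : ∀ l : Fin N, expand m' k₀ c (shiftRoot (rowRoot l)) = m' (rowRoot l) - c l := by
    simp [expand]
  have e3 : ∀ p : PosRoot N, expand m' k₀ c (shiftRoot (shiftRoot p)) = m' (shiftRoot p) := by
    simp [expand]
  simp only [e0, e1, e2, Nat.sub_add_cancel hk] at hQ
  unfold rootCoeff eliminationTerm
  rw [if_pos hk, ← mul_assoc, ← pow_add, add_comm (k₀ * _), hQ, pow_add, prod_posRoot_succ,
    prod_posRoot_succ, Fin.prod_univ_succ, prod_mul_distrib]
  simp only [e0, e1, e2, e3]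
  ring

/-- The fermionic formula, for the coefficient of `x^k`. -/
theorem IsPeelable.sum_fiber {K : ℕ → ℕ → ℕ → ℕ → ℕ} {ε : ℕ → ℕ → ℕ} (h : IsPeelable K ε)
    (hε : IsElimination ε) (N : ℕ) (k : Fin N → ℕ) :
    ∑ m ∈ fiber k, rootCoeff (quadForm K) m =
      PowerSeries.X ^ halfCartanForm k * ∏ i, qPochInv (k i) := by
  induction N with
  | zero =>
    have : IsEmpty (PosRoot (0 + 1)) :=
      ⟨fun a => by have := a.fst_lt_snd; have := a.snd_lt; omega⟩
    have : fiber k = univ := by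
      ext m
      simp only [mem_fiber, mem_univ, iff_true]
      exact fun i => i.elim0
    simp [this, rootCoeff, quadForm, halfCartanForm_fin_zero]
  | succ N ih =>
    obtain ⟨τ, hτ, hk⟩ := exists_halfCartanForm_add_mul k
    have hinner : ∀ m' ∈ fiber (fun i : Fin N => k i.succ),
        PowerSeries.X ^ (k 0 * τ) *
          ∑ m ∈ fiber k with contract m = m', rootCoeff (quadForm K) m =
        PowerSeries.X ^ (k 0 ^ 2) * qPochInv (k 0) * rootCoeff (quadForm K) m' := by
      intro m' hm'
      rw [sum_fiber_contract k hm', mul_sum, ← hτ m' hm']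
      have h1 : ∀ c ∈ (box (fun l => m' (rowRoot l))).filter (fun c => ∑ l, c l ≤ k 0), _ :=
        fun c hc => h.rootCoeff_expand (k 0) m' (mem_box.1 (mem_filter.1 hc).1) (mem_filter.1 hc).2
      rw [sum_congr rfl h1, ← mul_sum, sum_filter_of_ne, hε, rootCoeff, prod_posRoot_succ, pow_add]
      · ring
      · intro c _ hc
        by_contra hlt
        exact hc (if_neg hlt)
    -- Multiplying by q^{k_0 τ} avoids the possibly negative exponent k_0² - k_0 τ.
    have hne : (PowerSeries.X ^ (k 0 * τ) : ℤ⟦X⟧) ≠ 0 := pow_ne_zero _ PowerSeries.X_ne_zero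
    apply mul_left_cancel₀ hne
    rw [← sum_fiberwise_of_maps_to (fun m hm => contract_mem_fiber hm), mul_sum,
      sum_congr rfl hinner, ← mul_sum, ih, Fin.prod_univ_succ,
      ← mul_assoc (PowerSeries.X ^ _), ← pow_add, hk, pow_add]
    ring

/-! ### The two forms -/

/-- The coefficients of the form `B`. -/
def kernelB (i₁ j₁ i₂ j₂ : ℕ) : ℕ :=
  (if i₁ < i₂ ∧ j₁ < j₂ ∧ i₂ + 1 < j₁ then 1 else 0) + (if i₁ = i₂ ∧ j₁ ≤ j₂ then 1 else 0) +
    (if j₁ = j₂ ∧ i₁ < i₂ then 1 else 0) +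
    (if j₁ = i₁ + 1 ∧ i₂ < i₁ ∧ i₁ + 1 < j₂ then 1 else 0)

/-- The coefficients of the form `B'`. -/
def kernelB' (i₁ j₁ i₂ j₂ : ℕ) : ℕ :=
  if i₁ ≤ i₂ ∧ j₁ ≤ j₂ ∧ i₂ < j₁ then 1 else 0

theorem formB_eq_quadForm {n : ℕ} : (formB : (PosRoot n → ℕ) → ℕ) = quadForm kernelB := by
  funext m
  simp only [formB, quadForm, kernelB, add_mul, ite_mul, one_mul, zero_mul, sum_add_distrib]

theorem formB'_eq_quadForm {n : ℕ} : (formB' : (PosRoot n → ℕ) → ℕ) = quadForm kernelB' := by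
  funext m
  simp only [formB', quadForm, kernelB', ite_mul, one_mul, zero_mul]

/-- The last sum of B couples (1, 2) to every (0, j) with j > 2, while the first omits (0, 2) paired
with (1, j). Hence index 0 of ε comes ahead of the descending order. -/
theorem isPeelable_kernelB : IsPeelable kernelB zeroFirst where
  shift i j i' j' := by simp only [kernelB]; grind
  row_row l l' := by simp only [kernelB]; grind
  zero_row l := by simp only [kernelB]; grind
  zero_zero := by simp [kernelB]
  zero_shift i j h := by simp only [kernelB]; grind
  row_shift l i j h := by simp only [kernelB]; grind
  row_one l j := by simp only [kernelB, zeroFirst]; grind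

theorem isPeelable_kernelB' : IsPeelable kernelB' descending where
  shift i j i' j' := by simp only [kernelB']; grind
  row_row l l' := by simp only [kernelB']; grind
  zero_row l := by simp only [kernelB']; grind
  zero_zero := by simp [kernelB']
  zero_shift i j h := by simp only [kernelB']; grind
  row_shift l i j h := by simp only [kernelB']; grind
  row_one l j := by simp only [kernelB', descending]; grind

/-! ### From coefficients to power series -/

/-- A family of monomials in which every exponent occurs finitely often is summable. -/
theorem hasSum_xMonomial {n : ℕ} {ι : Type*} (e : ι → Fin (n - 1) → ℕ) (w : ι → ℤ⟦X⟧)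
    (s : (Fin (n - 1) → ℕ) → Finset ι) (hs : ∀ k i, i ∈ s k ↔ e i = k)
    {c : (Fin (n - 1) → ℕ) → ℤ⟦X⟧} (hc : ∀ k, ∑ i ∈ s k, w i = c k) :
    HasSum (fun i => (xMonomial (e i) (w i) : QXSeries n)) (fun k => c k) := by
  classical
  refine Pi.hasSum.2 fun k => ?_
  have hval : ∀ i, (xMonomial (e i) (w i) : QXSeries n) k = if e i = k then w i else 0 := by
    intro i
    change MvPowerSeries.coeff k (MvPowerSeries.monomial _ (w i)) = _
    rw [MvPowerSeries.coeff_monomial]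
    refine if_congr ?_ rfl rfl
    rw [eq_comm, Equiv.symm_apply_eq]
    rfl
  have hsum : ∑ i ∈ s k, (xMonomial (e i) (w i) : QXSeries n) k = c k := by
    rw [← hc]
    exact sum_congr rfl fun i hi => by rw [hval, if_pos ((hs _ _).1 hi)]
  rw [← hsum]
  refine hasSum_sum_of_ne_finset_zero fun i hi => ?_
  rw [hval, if_neg fun h => hi ((hs _ _).2 h)]

/-- The coefficient of `x^k` in the fermionic sum. -/
noncomputable def fermionicCoeff {r : ℕ} (k : Fin r → ℕ) : ℤ⟦X⟧ :=
  PowerSeries.X ^ halfCartanForm k * ∏ i, qPochInv (k i)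

/-- The fermionic sum, as a power series. -/
noncomputable def fermionicSeries (n : ℕ) : QXSeries n :=
  fun k => fermionicCoeff (r := n - 1) k

theorem hasSum_fermionicTerm (n : ℕ) :
    HasSum (fun k : Fin (n - 1) → ℕ => (fermionicTerm k : QXSeries n)) (fermionicSeries n) :=
  hasSum_xMonomial (fun k => k) fermionicCoeff (fun k => {k}) (by simp) (by simp)

theorem IsPeelable.hasSum_rootTerm {K : ℕ → ℕ → ℕ → ℕ → ℕ} {ε : ℕ → ℕ → ℕ} (h : IsPeelable K ε)
    (hε : IsElimination ε) (N : ℕ) :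
    HasSum (fun m : PosRoot (N + 1) → ℕ => (rootTerm (quadForm K) m : QXSeries (N + 1)))
      (fermionicSeries (N + 1)) :=
  hasSum_xMonomial lam (rootCoeff (quadForm K)) (fun k => fiber (N := N) k)
    (fun _ _ => mem_fiber.trans funext_iff.symm) (h.sum_fiber hε N)

end PrincipalSubspace

open PrincipalSubspace in
theorem theorem1p1 (n : ℕ) (hn : 2 ≤ n) :
    Summable (fun k : Fin (n - 1) → ℕ => (fermionicTerm k : QXSeries n)) ∧
    (Summable (fun m : PosRoot n → ℕ => (rootTerm formB m : QXSeries n)) ∧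
      ∑' m : PosRoot n → ℕ, (rootTerm formB m : QXSeries n) =
        ∑' k : Fin (n - 1) → ℕ, (fermionicTerm k : QXSeries n)) ∧
    (Summable (fun m : PosRoot n → ℕ => (rootTerm formB' m : QXSeries n)) ∧
      ∑' m : PosRoot n → ℕ, (rootTerm formB' m : QXSeries n) =
        ∑' k : Fin (n - 1) → ℕ, (fermionicTerm k : QXSeries n)) := by
  obtain ⟨N, rfl⟩ : ∃ N, n = N + 1 := ⟨n - 1, by omega⟩
  have hF := hasSum_fermionicTerm (N + 1)
  have hB := isPeelable_kernelB.hasSum_rootTerm isElimination_zeroFirst N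
  have hB' := isPeelable_kernelB'.hasSum_rootTerm isElimination_descending N
  rw [← formB_eq_quadForm] at hB
  rw [← formB'_eq_quadForm] at hB'
  exact ⟨hF.summable, ⟨hB.summable, hB.tsum_eq.trans hF.tsum_eq.symm⟩,
    hB'.summable, hB'.tsum_eq.trans hF.tsum_eq.symm⟩
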